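/- Let $k\ge 1$ and let $1\le s_1<s_2<\dots<s_k$ be fixed integers. For every integer $n>2s_k$ let $C_n(s_1,\dots,s_k)$ be the circulant graph with vertices $0,1,\dots,n-1$ in which the vertex $i$ is adjacent to the vertices $i\pm s_1,\dots,i\pm s_k \pmod n$, and let $f_G(n)$ be the number of rooted spanning forests of $G=C_n(s_1,\dots,s_k)$, that is, of pairs consisting of an acyclic subgraph of $G$ on the full vertex set and a choice of one root in each of its connected components. Let $p$ be the number of odd elements among $s_1,\dots,s_k$, and let $q$ be the square-free part of $4p+1$, that is, the unique square-free positive integer such that $4p+1=q\,r^2$ for some positive integer $r$. Then there exists an integer sequence $a(n)$ such that, for every integer $n>2s_k$, 1. $f_G(n)=a(n)^2$ if $n$ is odd; 2. $f_G(n)=q\,a(n)^2$ if $n$ is even. -/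

import Mathlib

/-- The circulant graph `C_n(s_1, …, s_k)`: its vertices are the residues modulo `n`, and distinct
vertices `i`, `j` are adjacent when `j ≡ i ± s_l (mod n)` for some `l`. -/
def circulant (n : ℕ) {k : ℕ} (s : Fin k → ℕ) : SimpleGraph (ZMod n) :=
  SimpleGraph.circulantGraph (Set.range fun l => (s l : ZMod n))

/-- The pair `(F, R)` is a rooted spanning forest of `G`: `F` is an acyclic subgraph of `G` on the
full vertex set, and the set `R` of roots has exactly one vertex in each component of `F`. -/
def IsRootedSpanningForest {V : Type*} (G F : SimpleGraph V) (R : Set V) : Prop :=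
  F ≤ G ∧ F.IsAcyclic ∧ ∀ c : F.ConnectedComponent, ∃! v : V, v ∈ R ∧ v ∈ c.supp

/-- The number of rooted spanning forests of a (finite) graph `G`. -/
noncomputable def numRootedSpanningForests {V : Type*} (G : SimpleGraph V) : ℕ :=
  Nat.card {x : SimpleGraph V × Set V // IsRootedSpanningForest G x.1 x.2}

/-- `q` is the square-free part of the positive integer `m`: `q` is square-free and `m = q * r ^ 2`
for a positive integer `r`. -/
def IsSquarefreePart (q m : ℕ) : Prop :=
  Squarefree q ∧ ∃ r : ℕ, 0 < r ∧ m = q * r ^ 2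

/-!
The number of rooted spanning forests of a graph with Laplacian `L` is `det (1 + L)`
(`numRootedSpanningForests_eq_det`). Each row of `1 + L` is a sum over the possible parents of its
vertex, none included, so that the determinant expands over parent functions; a parent function
contributes `1` if it describes a rooted forest and `0` otherwise, and every rooted forest arises
from exactly one parent function.

For the circulant graph, `A = 1 + L` acts on rational functions on `ℤ/n` and commutes with the
reflection `x ↦ -x` and with all translations. Its determinant is therefore the product of those on
the even and on the odd functions. The central difference `f (x + 1) - f (x - 1)` maps the even
functions onto the odd ones and commutes with `A`, so `det A = d * b ^ 2`, where `b` is the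
determinant on odd functions and `d` the one on the even functions of period two
(`det_circulantOp_eq_periodTwo_mul_sq`). For odd `n` these are the constants and `d = 1`. For even
`n` the alternating function joins them, with eigenvalue `4 p + 1`, so `d = 4 p + 1 = q r ^ 2`.

Thus the number of forests is `b ^ 2` or `q (r b) ^ 2`. Since it is an integer and `q` is
square-free, the rational number being squared is an integer (`exists_eq_mul_int_sq`); this way no
integrality of `b` itself, or of the eigenvalues of `A`, has to be discussed.
-/

open Finset

/-! ### Parent functions and the forests they describe -/

/-- A function `φ : V → Option V` is read as a parent function: `φ v = some w` says that `w` is the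
parent of `v`, and `φ v = none` that `v` is a root. `IsParent φ w v` says that `w` is the parent of
`v`. The function describes a rooted forest exactly when this relation is well-founded. -/
def IsParent {V : Type*} (φ : V → Option V) (w v : V) : Prop := φ v = some w

/-- The graph whose edges join each vertex to its parent. -/
def parentGraph {V : Type*} (φ : V → Option V) : SimpleGraph V := SimpleGraph.fromRel (IsParent φ)

section ParentFunctions

variable {V : Type*} {φ : V → Option V}

lemma IsParent.ne (h : WellFounded (IsParent φ)) {v w : V} (hw : IsParent φ w v) : w ≠ v := by
  rintro rfl
  exact h.irrefl.irrefl _ hw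

lemma parentGraph_adj (h : WellFounded (IsParent φ)) {v w : V} :
    (parentGraph φ).Adj v w ↔ IsParent φ v w ∨ IsParent φ w v := by
  rw [parentGraph, SimpleGraph.fromRel_adj]
  refine ⟨fun H => H.2, fun H => ⟨?_, H⟩⟩
  rcases H with H | H
  · exact H.ne h
  · exact (H.ne h).symm

/-- Every edge is a bridge: deleting the edge from `v` to its parent separates the descendants of
`v` from the rest. -/
lemma parentGraph_isAcyclic (h : WellFounded (IsParent φ)) : (parentGraph φ).IsAcyclic := by
  have key : ∀ v w, IsParent φ w v → (parentGraph φ).IsBridge s(v, w) := by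
    intro v w hvw
    rw [SimpleGraph.isBridge_iff]
    have hdesc : ∀ u, ((parentGraph φ).deleteEdges {s(v, w)}).Reachable v u →
        Relation.ReflTransGen (IsParent φ) v u := by
      intro u hu
      rw [SimpleGraph.reachable_iff_reflTransGen] at hu
      induction hu with
      | refl => exact .refl
      | @tail b c _ hbc ih =>
        rw [SimpleGraph.deleteEdges_adj, parentGraph_adj h] at hbc
        obtain ⟨hbc | hbc, hne⟩ := hbc
        · exact ih.tail hbc
        · rcases ih.cases_tail with rfl | ⟨d, hd, hdb⟩
          · have : c = w := Option.some.inj (hbc.symm.trans hvw)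
            subst this
            exact absurd rfl hne
          · have : c = d := Option.some.inj (hbc.symm.trans hdb)
            exact this ▸ hd
    intro hr
    have h2 : Relation.TransGen (IsParent φ) w w := Relation.TransGen.head' hvw (hdesc w hr)
    exact h.transGen.irrefl.irrefl _ h2
  rw [SimpleGraph.isAcyclic_iff_forall_adj_isBridge]
  intro v w hvw
  rw [parentGraph_adj h] at hvw
  rcases hvw with hvw | hvw
  · rw [Sym2.eq_swap]
    exact key _ _ hvw
  · exact key _ _ hvw

lemma exists_root_reachable (h : WellFounded (IsParent φ)) (v : V) :
    ∃ r, φ r = none ∧ (parentGraph φ).Reachable v r := by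
  induction v using h.induction with
  | _ v ih =>
    rcases hv : φ v with _ | w
    · exact ⟨v, hv, .refl _⟩
    · obtain ⟨r, hr, hwr⟩ := ih w hv
      have : (parentGraph φ).Adj v w := (parentGraph_adj h).2 (.inr hv)
      exact ⟨r, hr, this.reachable.trans hwr⟩

/-- A root that is an ancestor of a vertex is an ancestor of all vertices connected to it, and a
root is the only ancestor of itself. -/
lemma root_unique (h : WellFounded (IsParent φ)) {r r' : V} (hr : φ r = none) (hr' : φ r' = none)
    (hreach : (parentGraph φ).Reachable r r') : r = r' := by
  have hanc : Relation.ReflTransGen (IsParent φ) r r' := by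
    rw [SimpleGraph.reachable_iff_reflTransGen] at hreach
    clear hr'
    induction hreach with
    | refl => exact .refl
    | @tail b c _ hbc ih =>
      rcases (parentGraph_adj h).1 hbc with hbc | hbc
      · exact ih.tail hbc
      · rcases ih.cases_tail with rfl | ⟨d, hd, hdb⟩
        · exact absurd (hr.symm.trans hbc) (by simp)
        · have : c = d := Option.some.inj (hbc.symm.trans hdb)
          exact this ▸ hd
  rcases hanc.cases_tail with rfl | ⟨d, _, hd⟩
  · rfl
  · exact absurd (hr'.symm.trans hd) (by simp)

/-- The roots and the edges determine the parent function: if the edge from `v` to its `φ`-parent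
`w` were directed the other way by `ψ`, then, as `φ` and `ψ` agree at `w` by induction, `v` would be
the `φ`-parent of `w` too. -/
lemma eq_of_parentGraph_eq {ψ : V → Option V} (hφ : WellFounded (IsParent φ))
    (hψ : WellFounded (IsParent ψ)) (hG : parentGraph φ = parentGraph ψ)
    (hR : ∀ v, φ v = none ↔ ψ v = none) : φ = ψ := by
  funext v
  induction v using hφ.induction with
  | _ v ih =>
    rcases hv : φ v with _ | w
    · exact ((hR v).1 hv).symm
    · have hadj : (parentGraph ψ).Adj v w := hG ▸ (parentGraph_adj hφ).2 (.inr hv)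
      rcases (parentGraph_adj hψ).1 hadj with hw | hw
      · have hw' : φ w = some v := (ih w hv).trans hw
        exact absurd hv (hφ.asymmetric _ _ (show IsParent φ v w from hw'))
      · exact hw.symm

lemma parentGraph_isRootedSpanningForest (h : WellFounded (IsParent φ)) {G : SimpleGraph V}
    (hG : ∀ v w, φ v = some w → G.Adj v w) :
    IsRootedSpanningForest G (parentGraph φ) {v | φ v = none} := by
  refine ⟨?_, parentGraph_isAcyclic h, ?_⟩
  · intro v w hvw
    rcases (parentGraph_adj h).1 hvw with hvw | hvw
    · exact (hG _ _ hvw).symm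
    · exact hG _ _ hvw
  · intro c
    induction c using SimpleGraph.ConnectedComponent.ind with
    | _ v =>
    obtain ⟨r, hr, hvr⟩ := exists_root_reachable h v
    refine ⟨r, ⟨hr, ?_⟩, ?_⟩
    · simpa [SimpleGraph.ConnectedComponent.mem_supp_iff] using hvr.symm
    · rintro r' ⟨hr', hmem⟩
      simp only [SimpleGraph.ConnectedComponent.mem_supp_iff,
        SimpleGraph.ConnectedComponent.eq] at hmem
      exact root_unique h hr' hr (hmem.trans hvr)

/-- Every rooted forest comes from a parent function, which sends a vertex that is not a root to a
neighbour closer to the root of its component. -/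
lemma exists_parentFunction {G F : SimpleGraph V} {R : Set V} (h : IsRootedSpanningForest G F R) :
    ∃ φ : V → Option V, WellFounded (IsParent φ) ∧ (∀ v w, φ v = some w → G.Adj v w) ∧
      parentGraph φ = F ∧ {v | φ v = none} = R := by
  classical
  obtain ⟨hFG, hF, hR⟩ := h
  have hroot : ∀ v, ∃ r, r ∈ R ∧ F.Reachable r v ∧ ∀ r' ∈ R, F.Reachable r' v → r' = r := by
    intro v
    obtain ⟨r, ⟨hr, hrv⟩, hu⟩ := hR (F.connectedComponentMk v)
    simp only [SimpleGraph.ConnectedComponent.mem_supp_iff,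
      SimpleGraph.ConnectedComponent.eq] at hrv hu
    exact ⟨r, hr, hrv, fun r' hr' h' => hu r' ⟨hr', h'⟩⟩
  choose ρ hρR hρ hρu using hroot
  have hρadj : ∀ v w, F.Adj v w → ρ v = ρ w := fun v w hvw =>
    hρu w _ (hρR v) ((hρ v).trans hvw.reachable)
  have hstep : ∀ v, v ∉ R → ∃ w, F.Adj v w ∧ F.dist w (ρ v) < F.dist v (ρ v) := by
    intro v hv
    obtain ⟨p, hp⟩ := (hρ v).symm.exists_walk_length_eq_dist
    have hne : v ≠ ρ v := fun he => hv (he ▸ hρR v)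
    generalize ρ v = r at p hp hne
    cases p with
    | nil => exact absurd rfl hne
    | @cons _ w _ hvw p =>
      refine ⟨w, hvw, ?_⟩
      rw [← hp, SimpleGraph.Walk.length_cons]
      exact Nat.lt_succ_of_le (SimpleGraph.dist_le p)
  choose! π hπ hπd using hstep
  let φ : V → Option V := fun v => if v ∈ R then none else some (π v)
  have hφ : ∀ v w, φ v = some w → v ∉ R ∧ π v = w := by
    intro v w hvw
    by_cases hv : v ∈ R <;> simp [φ, hv] at hvw ⊢
    exact hvw
  have hφR : {v | φ v = none} = R := by
    ext v
    by_cases hv : v ∈ R <;> simp [φ, hv]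
  have hφF : ∀ v w, φ v = some w → F.Adj v w := by
    intro v w hvw
    obtain ⟨hv, rfl⟩ := hφ v w hvw
    exact hπ v hv
  have hwf : WellFounded (IsParent φ) := by
    refine Subrelation.wf (r := InvImage (· < ·) fun v => F.dist v (ρ v)) ?_
      (InvImage.wf _ wellFounded_lt)
    intro w v hwv
    obtain ⟨hv, rfl⟩ := hφ v w hwv
    have := hπd v hv
    simpa [InvImage, ← hρadj v _ (hπ v hv)] using this
  have hle : parentGraph φ ≤ F := by
    intro v w hvw
    rcases (parentGraph_adj hwf).1 hvw with hvw | hvw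
    · exact (hφF _ _ hvw).symm
    · exact hφF _ _ hvw
  refine ⟨φ, hwf, fun v w hvw => hFG (hφF v w hvw), le_antisymm hle ?_, hφR⟩
  intro v w hvw
  by_contra hn
  have hbridge := SimpleGraph.isAcyclic_iff_forall_adj_isBridge.1 hF hvw
  rw [SimpleGraph.isBridge_iff] at hbridge
  -- Both ends reach the common root of their component without using the edge between them.
  have hr : ∀ u, (parentGraph φ).Reachable u (ρ u) := by
    intro u
    obtain ⟨r, hr, hur⟩ := exists_root_reachable hwf u
    have hrR : r ∈ R := by rw [← hφR]; exact hr
    rwa [← hρu u r hrR (hur.symm.mono hle)]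
  have hreach : (parentGraph φ).Reachable v w := by
    have h1 := hr v
    rw [hρadj v w hvw] at h1
    exact h1.trans (hr w).symm
  refine hbridge (hreach.mono ?_)
  intro a b hab
  rw [SimpleGraph.deleteEdges_adj]
  refine ⟨hle hab, fun he => hn ?_⟩
  rw [Set.mem_singleton_iff, Sym2.eq_iff] at he
  rcases he with ⟨rfl, rfl⟩ | ⟨rfl, rfl⟩
  · exact hab
  · exact hab.symm

/-- Rooted spanning forests correspond to well-founded parent functions along the edges. -/
lemma numRootedSpanningForests_eq_card_parentFunctions (G : SimpleGraph V) :
    numRootedSpanningForests G = Nat.card {φ : V → Option V //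
      (∀ v w, φ v = some w → G.Adj v w) ∧ WellFounded (IsParent φ)} := by
  refine (Nat.card_congr (Equiv.ofBijective
    (fun φ => ⟨(parentGraph φ.1, {v | φ.1 v = none}),
      parentGraph_isRootedSpanningForest φ.2.2 φ.2.1⟩) ⟨?_, ?_⟩)).symm
  · rintro ⟨φ, _, hφ⟩ ⟨ψ, _, hψ⟩ h
    simp only [Subtype.mk.injEq, Prod.mk.injEq] at h ⊢
    exact eq_of_parentGraph_eq hφ hψ h.1 fun v => Set.ext_iff.1 h.2 v
  · rintro ⟨⟨F, R⟩, h⟩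
    obtain ⟨φ, hwf, hG, rfl, rfl⟩ := exists_parentFunction h
    exact ⟨⟨φ, hG, hwf⟩, rfl⟩

end ParentFunctions

/-! ### The matrix forest theorem -/

section MatrixForest

open Matrix

variable {V : Type*} [Fintype V] [DecidableEq V]

/-- The matrix whose row at `v` is the unit vector of `v` minus that of the parent of `v`, or just
the unit vector of `v` when `v` is a root. -/
def parentMatrix (φ : V → Option V) : Matrix V V ℚ :=
  Matrix.of fun v w => (1 : Matrix V V ℚ) v w - if φ v = some w then 1 else 0

lemma parentMatrix_mulVec (φ : V → Option V) (f : V → ℚ) (v : V) :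
    (parentMatrix φ *ᵥ f) v = f v - (φ v).elim 0 f := by
  rcases h : φ v with _ | u <;>
    simp [parentMatrix, mulVec, dotProduct, h, sub_mul, Finset.sum_sub_distrib, Matrix.one_apply]

/-- Ordered by depth, the matrix is unitriangular. -/
lemma det_parentMatrix_of_wellFounded {φ : V → Option V} (h : WellFounded (IsParent φ)) :
    (parentMatrix φ).det = 1 := by
  classical
  have : IsWellFounded V (IsParent φ) := ⟨h⟩
  have hlt : ∀ v w, φ v = some w →
      IsWellFounded.rank (IsParent φ) w < IsWellFounded.rank (IsParent φ) v :=
    fun v w hvw => IsWellFounded.rank_lt_of_rel hvw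
  have happ : ∀ v w, parentMatrix φ v w = (1 : Matrix V V ℚ) v w ∨ φ v = some w := by
    intro v w
    by_cases hvw : φ v = some w
    · exact .inr hvw
    · exact .inl (by simp [parentMatrix, hvw])
  have htri : (parentMatrix φ)ᵀ.BlockTriangular (IsWellFounded.rank (IsParent φ)) := by
    intro v w hvw
    rw [transpose_apply]
    rcases happ w v with h1 | h1
    · rw [h1, Matrix.one_apply_ne]
      rintro rfl
      exact lt_irrefl _ hvw
    · exact absurd (hlt _ _ h1) hvw.not_gt
  rw [← det_transpose, htri.det]
  refine Finset.prod_eq_one fun a _ => ?_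
  convert Matrix.det_one (n := {v // IsWellFounded.rank (IsParent φ) v = a}) (R := ℚ)
  ext ⟨v, hv⟩ ⟨w, hw⟩
  rw [toSquareBlock_def, of_apply, transpose_apply]
  rcases happ w v with h1 | h1
  · rw [h1]
    simp [Matrix.one_apply, eq_comm]
  · exact absurd (hlt _ _ h1) (by rw [hv, hw]; exact lt_irrefl _)

/-- The vertices without a root among their ancestors are closed under taking and forming parents,
so their indicator function is in the kernel of the matrix. -/
lemma det_parentMatrix_of_not_wellFounded {φ : V → Option V} (h : ¬ WellFounded (IsParent φ)) :
    (parentMatrix φ).det = 0 := by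
  classical
  rw [← Matrix.exists_mulVec_eq_zero_iff]
  refine ⟨fun v => if Acc (IsParent φ) v then 0 else 1, ?_, ?_⟩
  · intro h0
    refine h ⟨fun v => ?_⟩
    by_contra hv
    simpa [hv] using congrFun h0 v
  · funext v
    rw [parentMatrix_mulVec, Pi.zero_apply]
    rcases hv : φ v with _ | w
    · have : Acc (IsParent φ) v :=
        ⟨_, fun w hw => absurd (hv.symm.trans hw) (by simp)⟩
      simp [this]
    · have : Acc (IsParent φ) v ↔ Acc (IsParent φ) w := by
        refine ⟨fun H => H.inv hv, fun H => ⟨_, fun u hu => ?_⟩⟩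
        rwa [← Option.some.inj (hv.symm.trans hu)]
      simp [this]

/-- The matrix forest theorem: expand each row of `1 + L` as the sum of the rows that the choice of
a parent (or of none) for the vertex gives. -/
theorem numRootedSpanningForests_eq_det (G : SimpleGraph V) [DecidableRel G.Adj] :
    (numRootedSpanningForests G : ℚ) = (1 + G.lapMatrix ℚ).det := by
  classical
  let c : V → Option V → ℚ := fun v o => o.elim 1 fun w => if G.Adj v w then 1 else 0
  have hrow : (1 + G.lapMatrix ℚ) = fun v => ∑ o : Option V, c v o •
      (fun w => (1 : Matrix V V ℚ) v w - if o = some w then 1 else 0 : V → ℚ) := by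
    funext v w
    have hdeg : (G.degree v : ℚ) = ∑ u, if G.Adj v u then (1 : ℚ) else 0 :=
      G.degree_eq_sum_if_adj v
    simp only [Fintype.sum_option, Finset.sum_apply, Pi.smul_apply, c]
    by_cases hvw : v = w
    · subst hvw
      simp [SimpleGraph.lapMatrix, SimpleGraph.degMatrix, mul_sub, hdeg, Matrix.add_apply]
    · simp [SimpleGraph.lapMatrix, SimpleGraph.degMatrix, hvw, Matrix.add_apply]
  have hexp : (1 + G.lapMatrix ℚ).det =
      ∑ φ : V → Option V, (∏ v, c v (φ v)) • (parentMatrix φ).det := by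
    rw [hrow]
    refine (MultilinearMap.map_sum
      (detRowAlternating (n := V) (R := ℚ)).toMultilinearMap _).trans ?_
    refine Finset.sum_congr rfl fun φ _ => ?_
    exact MultilinearMap.map_smul_univ (detRowAlternating (n := V) (R := ℚ)).toMultilinearMap
      (fun v => c v (φ v)) _
  rw [hexp, numRootedSpanningForests_eq_card_parentFunctions, Nat.card_eq_fintype_card,
    Fintype.card_subtype, Finset.natCast_card_filter]
  refine Finset.sum_congr rfl fun φ _ => ?_
  by_cases hwf : WellFounded (IsParent φ)
  · rw [det_parentMatrix_of_wellFounded hwf, smul_eq_mul, mul_one]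
    by_cases hG : ∀ v w, φ v = some w → G.Adj v w
    · rw [if_pos ⟨hG, hwf⟩, Finset.prod_eq_one]
      intro v _
      rcases hv : φ v with _ | w
      · rfl
      · simp [c, hG v w hv]
    · rw [if_neg fun H => hG H.1]
      push Not at hG
      obtain ⟨v, w, hv, hn⟩ := hG
      exact (Finset.prod_eq_zero (Finset.mem_univ v) (by simp [c, hv, hn])).symm
  · rw [det_parentMatrix_of_not_wellFounded hwf, smul_zero, if_neg fun H => hwf H.2]

end MatrixForest

/-! ### Determinants and intertwining maps -/

/-- If `T` is onto and intertwines `e` and `e'`, then the determinant of `e` is that of `e` on the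
kernel of `T` times that of `e'`. -/
lemma LinearMap.det_eq_det_restrict_ker_mul_det {K V W : Type*} [Field K] [AddCommGroup V]
    [Module K V] [Module.Finite K V] [AddCommGroup W] [Module K W] (T : V →ₗ[K] W)
    (hT : Function.Surjective T) (e : V →ₗ[K] V) (e' : W →ₗ[K] W)
    (h : ∀ v, T (e v) = e' (T v)) (hker : ∀ v ∈ LinearMap.ker T, e v ∈ LinearMap.ker T) :
    LinearMap.det e = LinearMap.det (e.restrict hker) * LinearMap.det e' := by
  rw [LinearMap.det_eq_det_mul_det (LinearMap.ker T) e hker]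
  congr 1
  rw [← LinearMap.det_conj _ (T.quotKerEquivOfSurjective hT)]
  congr 1
  refine LinearMap.ext fun w => ?_
  obtain ⟨v, rfl⟩ := hT w
  have : (T.quotKerEquivOfSurjective hT).symm (T v) = (LinearMap.ker T).mkQ v := by
    rw [LinearEquiv.symm_apply_eq]
    rfl
  simp only [LinearMap.comp_apply, LinearEquiv.coe_coe, this]
  exact h v

/-- If the functional `T` is an eigenvector of the transpose of `e` for the eigenvalue `c`, and `e`
fixes the kernel of `T` pointwise, then `e` has determinant `c`. -/
lemma LinearMap.det_eq_of_functional {K V : Type*} [Field K] [AddCommGroup V] [Module K V]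
    [Module.Finite K V] (T : V →ₗ[K] K) (hT : Function.Surjective T) (e : V →ₗ[K] V) (c : K)
    (h : ∀ v, T (e v) = c * T v) (hfix : ∀ v, T v = 0 → e v = v) : LinearMap.det e = c := by
  have hker : ∀ v ∈ LinearMap.ker T, e v ∈ LinearMap.ker T := fun v hv => by
    rwa [hfix v hv]
  rw [LinearMap.det_eq_det_restrict_ker_mul_det T hT e (c • LinearMap.id) h hker]
  have : e.restrict hker = LinearMap.id :=
    LinearMap.ext fun v => Subtype.ext (hfix v v.2)
  rw [this, LinearMap.det_id, LinearMap.det_smul, LinearMap.det_id, Module.finrank_self]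
  ring

/-! ### The circulant operator and its symmetries -/

section Circulant

variable {n : ℕ} {k : ℕ} (s : Fin k → ℕ)

/-- The matrix `1 + L` of the circulant graph, as an operator on functions on `ℤ/n`. -/
def circulantOp (n : ℕ) {k : ℕ} (s : Fin k → ℕ) : (ZMod n → ℚ) →ₗ[ℚ] (ZMod n → ℚ) where
  toFun f x := f x + ∑ l, (2 * f x - f (x + s l) - f (x - s l))
  map_add' f g := by
    funext x
    simp only [Pi.add_apply]
    rw [add_add_add_comm, ← Finset.sum_add_distrib]
    congr 1
    exact Finset.sum_congr rfl fun _ _ => by ring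
  map_smul' c f := by
    funext x
    simp only [Pi.smul_apply, smul_eq_mul, RingHom.id_apply, mul_add, Finset.mul_sum]
    congr 1
    exact Finset.sum_congr rfl fun _ _ => by ring

lemma circulantOp_apply (f : ZMod n → ℚ) (x : ZMod n) :
    circulantOp n s f x = f x + ∑ l, (2 * f x - f (x + s l) - f (x - s l)) := rfl

/-- The vertices `x ± s_l` are distinct because `0 < s_l < n / 2`. -/
lemma circulant_neighbors_injective [NeZero n] (hpos : ∀ i, 1 ≤ s i) (hs : Function.Injective s)
    (hn : ∀ i, 2 * s i < n) :
    Function.Injective (Sum.elim (fun l => (s l : ZMod n)) fun l => -(s l : ZMod n)) := by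
  have hcast : ∀ a b : ℕ, a < n → b < n → (a : ZMod n) = b → a = b := by
    intro a b ha hb hab
    rw [ZMod.natCast_eq_natCast_iff'] at hab
    rwa [Nat.mod_eq_of_lt ha, Nat.mod_eq_of_lt hb] at hab
  have hne : ∀ l l', (s l : ZMod n) ≠ -(s l' : ZMod n) := by
    intro l l' h
    have h1 : ((s l + s l' : ℕ) : ZMod n) = (0 : ℕ) := by
      push_cast
      rw [h, neg_add_cancel]
    have := hcast _ _ (by have := hn l; have := hn l'; omega) (Nat.pos_of_neZero n) h1
    have := hpos l
    omega
  have hinj : ∀ l l', (s l : ZMod n) = s l' → l = l' := fun l l' h =>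
    hs (hcast _ _ (by have := hn l; omega) (by have := hn l'; omega) h)
  rintro (l | l) (l' | l') h
  · exact congrArg _ (hinj _ _ h)
  · exact absurd h (hne _ _)
  · exact absurd h.symm (hne _ _)
  · exact congrArg _ (hinj _ _ (neg_injective h))

lemma toLin'_one_add_lapMatrix_circulant [NeZero n] [DecidableRel (circulant n s).Adj]
    (hpos : ∀ i, 1 ≤ s i) (hs : Function.Injective s) (hn : ∀ i, 2 * s i < n) :
    Matrix.toLin' (1 + (circulant n s).lapMatrix ℚ) = circulantOp n s := by
  classical
  have hinj := circulant_neighbors_injective s hpos hs hn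
  have hne : ∀ l, (s l : ZMod n) ≠ 0 := by
    intro l h
    have : Sum.inl l = (Sum.inr l : Fin k ⊕ Fin k) := hinj (by simp [h])
    simp at this
  have hnb : ∀ x : ZMod n, (circulant n s).neighborFinset x = Finset.univ.image
      fun t => x + Sum.elim (fun l => (s l : ZMod n)) (fun l => -(s l : ZMod n)) t := by
    intro x
    ext y
    rw [SimpleGraph.mem_neighborFinset, circulant, SimpleGraph.circulantGraph_adj]
    simp only [Set.mem_range, Finset.mem_image, Finset.mem_univ, true_and, Sum.exists, Sum.elim_inl,
      Sum.elim_inr]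
    constructor
    · rintro ⟨-, ⟨l, hl⟩ | ⟨l, hl⟩⟩
      · exact .inr ⟨l, by rw [hl]; ring⟩
      · exact .inl ⟨l, by rw [hl]; ring⟩
    · rintro (⟨l, rfl⟩ | ⟨l, rfl⟩)
      · exact ⟨by simpa using (hne l), .inr ⟨l, by ring⟩⟩
      · exact ⟨by simpa using (hne l), .inl ⟨l, by ring⟩⟩
  have hsum : ∀ (x : ZMod n) (f : ZMod n → ℚ), ∑ y ∈ (circulant n s).neighborFinset x, f y =
      ∑ l, f (x + s l) + ∑ l, f (x - s l) := by
    intro x f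
    rw [hnb, Finset.sum_image (fun a _ b _ h => hinj (add_left_cancel h)), Fintype.sum_sum_type]
    simp [sub_eq_add_neg]
  refine LinearMap.ext fun f => funext fun x => ?_
  have hdeg : ((circulant n s).degree x : ℚ) = k + k := by
    have := hsum x fun _ => 1
    simpa using this
  rw [Matrix.toLin'_apply, Matrix.add_mulVec, Matrix.one_mulVec, Pi.add_apply,
    SimpleGraph.lapMatrix_mulVec_apply, hsum, hdeg, circulantOp_apply]
  simp only [Finset.sum_sub_distrib, Finset.sum_const, Finset.card_univ, Fintype.card_fin,
    nsmul_eq_mul]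
  ring

/-- The odd functions on `ℤ/n`. -/
def oddFunctions (n : ℕ) : Submodule ℚ (ZMod n → ℚ) where
  carrier := {f | ∀ x, f (-x) = -f x}
  add_mem' := by
    intro f g hf hg x
    simp only [Pi.add_apply, hf x, hg x]
    ring
  zero_mem' := by simp
  smul_mem' := by
    intro c f hf x
    simp [hf x]

/-- Twice the odd part of a function. Its kernel consists of the even functions. -/
def oddPart (n : ℕ) : (ZMod n → ℚ) →ₗ[ℚ] oddFunctions n where
  toFun f := ⟨fun x => f x - f (-x), fun x => by
    simp only [neg_neg, neg_sub]⟩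
  map_add' f g := by
    ext x
    simp only [Pi.add_apply, Submodule.coe_add]
    ring
  map_smul' c f := by
    ext x
    simp [mul_sub]

/-- The even functions on `ℤ/n`. -/
abbrev evenFunctions (n : ℕ) : Submodule ℚ (ZMod n → ℚ) := LinearMap.ker (oddPart n)

lemma mem_evenFunctions {f : ZMod n → ℚ} : f ∈ evenFunctions n ↔ ∀ x, f (-x) = f x := by
  rw [LinearMap.mem_ker, Subtype.ext_iff, funext_iff]
  exact forall_congr' fun x => by
    rw [eq_comm (a := f (-x)), ← sub_eq_zero (a := f x)]
    rfl

lemma oddPart_surjective : Function.Surjective (oddPart n) := by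
  rintro ⟨g, hg⟩
  refine ⟨fun x => g x / 2, ?_⟩
  ext x
  have := hg x
  simp only [oddPart, LinearMap.coe_mk, AddHom.coe_mk, this]
  ring

lemma circulantOp_mem_odd {f : ZMod n → ℚ} (hf : f ∈ oddFunctions n) :
    circulantOp n s f ∈ oddFunctions n := by
  intro x
  rw [circulantOp_apply, circulantOp_apply, neg_add, ← Finset.sum_neg_distrib, hf x]
  congr 1
  refine Finset.sum_congr rfl fun l _ => ?_
  have h1 := hf (x - s l)
  have h2 := hf (x + s l)
  rw [neg_sub'] at h1
  rw [neg_add'] at h2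
  rw [sub_neg_eq_add] at h1
  rw [h1, h2]
  ring

lemma circulantOp_mem_even {f : ZMod n → ℚ} (hf : f ∈ evenFunctions n) :
    circulantOp n s f ∈ evenFunctions n := by
  rw [mem_evenFunctions] at *
  intro x
  rw [circulantOp_apply, circulantOp_apply, hf x]
  congr 1
  refine Finset.sum_congr rfl fun l _ => ?_
  have h1 := hf (x - s l)
  have h2 := hf (x + s l)
  rw [neg_sub'] at h1
  rw [neg_add'] at h2
  rw [sub_neg_eq_add] at h1
  rw [h1, h2]
  ring

/-- The circulant operator on odd functions. -/
def circulantOpOdd (n : ℕ) {k : ℕ} (s : Fin k → ℕ) : oddFunctions n →ₗ[ℚ] oddFunctions n :=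
  (circulantOp n s).restrict fun _ hf => circulantOp_mem_odd s hf

/-- The circulant operator on even functions. -/
def circulantOpEven (n : ℕ) {k : ℕ} (s : Fin k → ℕ) : evenFunctions n →ₗ[ℚ] evenFunctions n :=
  (circulantOp n s).restrict fun _ hf => circulantOp_mem_even s hf

lemma det_circulantOp_eq_even_mul_odd [NeZero n] : LinearMap.det (circulantOp n s) =
    LinearMap.det (circulantOpEven n s) * LinearMap.det (circulantOpOdd n s) := by
  refine LinearMap.det_eq_det_restrict_ker_mul_det (oddPart n) oddPart_surjective _ _ ?_ _
  intro f
  ext x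
  change circulantOp n s f x - circulantOp n s f (-x) =
    circulantOp n s (fun y => f y - f (-y)) x
  simp only [circulantOp_apply]
  rw [add_sub_add_comm, ← Finset.sum_sub_distrib]
  congr 1
  refine Finset.sum_congr rfl fun l _ => ?_
  rw [neg_add', neg_sub', sub_neg_eq_add]
  ring

/-- The central difference maps even functions to odd ones. -/
def centralDiff (n : ℕ) : evenFunctions n →ₗ[ℚ] oddFunctions n where
  toFun f := ⟨fun x => f.1 (x + 1) - f.1 (x - 1), fun x => by
    have h := mem_evenFunctions.1 f.2
    have h1 := h (x + 1)
    have h2 := h (x - 1)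
    rw [neg_add'] at h1
    rw [neg_sub', sub_neg_eq_add] at h2
    simp only [h1, h2]
    ring⟩
  map_add' f g := by
    ext x
    simp only [Submodule.coe_add, Pi.add_apply]
    ring
  map_smul' c f := by
    ext x
    simp [mul_sub]

lemma periodic_of_centralDiff_eq_zero {f : ZMod n → ℚ} (hf : ∀ x, f (x + 1) - f (x - 1) = 0)
    (x : ZMod n) (m : ℕ) : f (x + 2 * m) = f x := by
  induction m with
  | zero => simp
  | succ m ih =>
    rw [← ih, ← sub_eq_zero, ← hf (x + 2 * m + 1)]
    congr 2
    · push_cast; ring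
    · ring

/-- The square of the central difference is injective on odd functions, hence onto: if it kills an
odd `g`, then the central difference `h` of `g` has period two, so that `n` steps of length two
change `g` by `n h` but lead back to the start; hence `h = 0`, so `g` has period two, is even, and
vanishes. -/
lemma centralDiff_surjective [NeZero n] : Function.Surjective (centralDiff n) := by
  let D' : oddFunctions n →ₗ[ℚ] evenFunctions n :=
    { toFun := fun g => ⟨fun x => g.1 (x + 1) - g.1 (x - 1), mem_evenFunctions.2 fun x => by
        have h := g.2
        have h1 := h (x + 1)
        have h2 := h (x - 1)
        rw [neg_add'] at h1
        rw [neg_sub', sub_neg_eq_add] at h2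
        rw [h1, h2]
        ring⟩
      map_add' := fun f g => by
        ext x
        simp only [Submodule.coe_add, Pi.add_apply]
        ring
      map_smul' := fun c f => by
        ext x
        simp [mul_sub] }
  have hinj : Function.Injective (centralDiff n ∘ₗ D') := by
    rw [injective_iff_map_eq_zero]
    intro g hg
    have hh : ∀ x, (D' g).1 (x + 1) - (D' g).1 (x - 1) = 0 := fun x =>
      congrFun (congrArg Subtype.val hg) x
    have hg' : ∀ x, (D' g).1 x = g.1 (x + 1) - g.1 (x - 1) := fun _ => rfl
    have hiter : ∀ (x : ZMod n) (m : ℕ), g.1 (x + 2 * m) = g.1 x + m * (D' g).1 (x + 1) := by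
      intro x m
      induction m with
      | zero => simp
      | succ m ih =>
        -- The step of `g` around the centre `x + 1 + 2 m` has the size of the one around `x + 1`.
        have h1 := hg' (x + 1 + 2 * m)
        rw [periodic_of_centralDiff_eq_zero hh] at h1
        have e1 : x + 1 + 2 * (m : ZMod n) + 1 = x + 2 * ((m + 1 : ℕ) : ZMod n) := by
          push_cast; ring
        have e2 : x + 1 + 2 * (m : ZMod n) - 1 = x + 2 * m := by ring
        rw [e1, e2, ih] at h1
        push_cast at h1 ⊢
        linarith
    have h0 : ∀ x, g.1 (x + 1) - g.1 (x - 1) = 0 := by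
      intro x
      have h1 := hiter (x - 1) n
      rw [ZMod.natCast_self, mul_zero, add_zero, sub_add_cancel] at h1
      have h2 : (n : ℚ) ≠ 0 := Nat.cast_ne_zero.2 (NeZero.ne n)
      have h3 : (n : ℚ) * (D' g).1 x = 0 := by linarith
      rw [← hg']
      exact (mul_eq_zero.1 h3).resolve_left h2
    ext x
    have h1 := periodic_of_centralDiff_eq_zero h0 x (-x).val
    rw [ZMod.natCast_zmod_val, show x + 2 * -x = -x by ring, g.2 x] at h1
    change g.1 x = 0
    linarith
  intro g
  obtain ⟨f, hf⟩ := LinearMap.injective_iff_surjective.1 hinj g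
  exact ⟨D' f, hf⟩

lemma centralDiff_circulantOpEven (f : evenFunctions n) :
    centralDiff n (circulantOpEven n s f) = circulantOpOdd n s (centralDiff n f) := by
  ext x
  change circulantOp n s f.1 (x + 1) - circulantOp n s f.1 (x - 1) =
    circulantOp n s (fun y => f.1 (y + 1) - f.1 (y - 1)) x
  simp only [circulantOp_apply]
  rw [add_sub_add_comm, ← Finset.sum_sub_distrib]
  congr 1
  refine Finset.sum_congr rfl fun l _ => ?_
  rw [add_right_comm x 1, sub_add_eq_add_sub x 1, add_sub_right_comm x 1, sub_right_comm x 1]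
  ring

/-! ### The functions of period two -/

/-- The even functions on `ℤ/n` that have period two: the constants and, if `n` is even, the
alternating function span them. -/
abbrev evenPeriodTwo (n : ℕ) : Submodule ℚ (evenFunctions n) := LinearMap.ker (centralDiff n)

lemma circulantOpEven_mem_evenPeriodTwo (f : evenFunctions n) (hf : f ∈ evenPeriodTwo n) :
    circulantOpEven n s f ∈ evenPeriodTwo n := by
  rw [LinearMap.mem_ker, centralDiff_circulantOpEven, LinearMap.mem_ker.1 hf, map_zero]

/-- The circulant operator on the even functions of period two. -/
def circulantOpPeriodTwo (n : ℕ) {k : ℕ} (s : Fin k → ℕ) :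
    evenPeriodTwo n →ₗ[ℚ] evenPeriodTwo n :=
  (circulantOpEven n s).restrict (circulantOpEven_mem_evenPeriodTwo s)

/-- The central difference identifies the even functions modulo those of period two with the odd
functions, so that the odd determinant occurs twice. -/
lemma det_circulantOp_eq_periodTwo_mul_sq [NeZero n] : LinearMap.det (circulantOp n s) =
    LinearMap.det (M := evenPeriodTwo n) (circulantOpPeriodTwo n s) *
      LinearMap.det (circulantOpOdd n s) ^ 2 := by
  rw [det_circulantOp_eq_even_mul_odd, LinearMap.det_eq_det_restrict_ker_mul_det (centralDiff n)
    centralDiff_surjective _ _ (centralDiff_circulantOpEven s) (circulantOpEven_mem_evenPeriodTwo s),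
    pow_two, mul_assoc]
  rfl

/-- On functions of period two only the odd `s_l` contribute, each by `2 (f x - f (x + 1))`. -/
lemma circulantOp_apply_of_periodic {f : ZMod n → ℚ} (hf : ∀ x, f (x + 1) - f (x - 1) = 0)
    (x : ZMod n) : circulantOp n s f x =
      f x + 2 * Nat.card {i : Fin k // Odd (s i)} * (f x - f (x + 1)) := by
  classical
  have hadd : ∀ (x : ZMod n) (m : ℕ), f (x + m) = if Odd m then f (x + 1) else f x := by
    intro x m
    split_ifs with hm
    · obtain ⟨r, rfl⟩ := hm
      rw [← periodic_of_centralDiff_eq_zero hf (x + 1) r]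
      congr 1
      push_cast
      ring
    · obtain ⟨r, rfl⟩ := Nat.not_odd_iff_even.1 hm
      rw [← periodic_of_centralDiff_eq_zero hf x r]
      congr 1
      push_cast
      ring
  have hsub : ∀ (x : ZMod n) (m : ℕ), f (x - m) = f (x + m) := by
    intro x m
    rw [← periodic_of_centralDiff_eq_zero hf (x - m) m]
    congr 1
    ring
  rw [circulantOp_apply]
  congr 1
  rw [Nat.card_eq_fintype_card, Fintype.card_subtype, Finset.natCast_card_filter, Finset.mul_sum,
    Finset.sum_mul]
  refine Finset.sum_congr rfl fun l _ => ?_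
  rw [hsub, hadd]
  split_ifs <;> ring

lemma eq_apply_zero_of_periodic [NeZero n] {f : ZMod n → ℚ} (hf : ∀ x, f (x + 1) - f (x - 1) = 0)
    (h01 : f 0 = f 1) (x : ZMod n) : f x = f 0 := by
  rw [← ZMod.natCast_zmod_val x]
  rcases Nat.even_or_odd' x.val with ⟨r, hr | hr⟩ <;> rw [hr]
  · have := periodic_of_centralDiff_eq_zero hf 0 r
    simpa using this
  · have := periodic_of_centralDiff_eq_zero hf 1 r
    rw [h01, ← this]
    congr 1
    push_cast
    ring

lemma circulantOp_eq_self_of_periodic [NeZero n] {f : ZMod n → ℚ}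
    (hf : ∀ x, f (x + 1) - f (x - 1) = 0) (h01 : f 0 = f 1) : circulantOp n s f = f := by
  funext x
  rw [circulantOp_apply_of_periodic s hf, eq_apply_zero_of_periodic hf h01 x,
    eq_apply_zero_of_periodic hf h01 (x + 1)]
  ring

lemma evenPeriodTwo_sub_eq_zero (f : evenPeriodTwo n) (x : ZMod n) :
    f.1.1 (x + 1) - f.1.1 (x - 1) = 0 :=
  congrFun (congrArg Subtype.val (LinearMap.mem_ker.1 f.2)) x

lemma det_circulantOpPeriodTwo_of_odd [NeZero n] (hn : Odd n) :
    LinearMap.det (M := evenPeriodTwo n) (circulantOpPeriodTwo n s) = 1 := by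
  have : circulantOpPeriodTwo n s = LinearMap.id := by
    refine LinearMap.ext fun f => Subtype.ext (Subtype.ext ?_)
    refine circulantOp_eq_self_of_periodic s (evenPeriodTwo_sub_eq_zero f) ?_
    obtain ⟨r, hr⟩ := hn
    have h0 : (1 + 2 * r : ZMod n) = 0 := by
      have : ((2 * r + 1 : ℕ) : ZMod n) = 0 := by rw [← hr, ZMod.natCast_self]
      rw [← this]
      push_cast
      ring
    have h1 := periodic_of_centralDiff_eq_zero (evenPeriodTwo_sub_eq_zero f) 1 r
    rwa [h0] at h1
  rw [this, LinearMap.det_id]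

/-- The operator fixes the constants. The even functions of period two modulo the constants form a
line, spanned by the alternating function, whose eigenvalue is `4 p + 1`. -/
lemma det_circulantOpPeriodTwo_of_even [NeZero n] (hn : Even n) :
    LinearMap.det (M := evenPeriodTwo n) (circulantOpPeriodTwo n s) =
      4 * Nat.card {i : Fin k // Odd (s i)} + 1 := by
  set p := Nat.card {i : Fin k // Odd (s i)}
  -- A function of period two is constant when its values at `0` and `1` agree.
  let T : evenPeriodTwo n →ₗ[ℚ] ℚ :=
    { toFun := fun f => f.1.1 0 - f.1.1 1
      map_add' := fun f g => by
        simp only [Submodule.coe_add, Pi.add_apply]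
        ring
      map_smul' := fun c f => by simp [mul_sub] }
  have hTapp : ∀ f, T f = f.1.1 0 - f.1.1 1 := fun _ => rfl
  have hT : Function.Surjective T := by
    intro c
    let π := ZMod.castHom hn.two_dvd (ZMod 2)
    let f : ZMod n → ℚ := fun x => if π x = 0 then c else 0
    have hf : f ∈ evenFunctions n := mem_evenFunctions.2 fun x => by simp [f]
    refine ⟨⟨⟨f, hf⟩, ?_⟩, ?_⟩
    · rw [LinearMap.mem_ker]
      ext x
      have : π (x + 1) = π (x - 1) := by
        rw [map_add, map_sub, map_one, CharTwo.sub_eq_add]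
      change f (x + 1) - f (x - 1) = 0
      simp only [f, this, sub_self]
    · rw [hTapp]
      simp [f]
  refine LinearMap.det_eq_of_functional T hT _ _ ?_ ?_
  · intro f
    have hf := evenPeriodTwo_sub_eq_zero f
    change circulantOp n s f.1.1 0 - circulantOp n s f.1.1 1 = (4 * p + 1 : ℚ) * T f
    have h2 : f.1.1 (1 + 1) = f.1.1 0 := by
      have := hf 1
      rw [sub_self] at this
      exact sub_eq_zero.1 this
    rw [circulantOp_apply_of_periodic s hf, circulantOp_apply_of_periodic s hf, hTapp, zero_add, h2]
    ring
  · intro f hf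
    refine Subtype.ext (Subtype.ext ?_)
    exact circulantOp_eq_self_of_periodic s (evenPeriodTwo_sub_eq_zero f) (sub_eq_zero.1 hf)

end Circulant

/-! ### Integrality of the square root -/

/-- A natural number that is `q` times a rational square, `q` square-free, is `q` times an integer
square. -/
lemma exists_eq_mul_int_sq {N q : ℕ} (hq : Squarefree q) {c : ℚ} (h : (N : ℚ) = q * c ^ 2) :
    ∃ a : ℤ, (N : ℤ) = q * a ^ 2 := by
  have hsq : IsSquare (q * N) := by
    rw [← Rat.isSquare_natCast_iff]
    exact ⟨q * c, by push_cast; rw [h]; ring⟩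
  obtain ⟨m, hm⟩ := hsq
  have hdvd : q ∣ m := by
    rw [← hq.dvd_pow_iff_dvd two_ne_zero, pow_two, ← hm]
    exact dvd_mul_right _ _
  obtain ⟨t, rfl⟩ := hdvd
  have hN : N = q * t ^ 2 := by
    refine Nat.eq_of_mul_eq_mul_left (Nat.pos_of_ne_zero hq.ne_zero) (hm.trans ?_)
    ring
  exact ⟨t, by rw [hN]; push_cast; ring⟩

theorem theorem3 (k : ℕ) (s : Fin k → ℕ) (hs_pos : ∀ i, 1 ≤ s i) (hs : StrictMono s)
    (p q : ℕ) (hp : p = Nat.card {i : Fin k // Odd (s i)})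
    (hq : IsSquarefreePart q (4 * p + 1)) :
    ∃ a : ℕ → ℤ, ∀ n : ℕ, 0 < n → (∀ i, 2 * s i < n) →
      (Odd n → (numRootedSpanningForests (circulant n s) : ℤ) = a n ^ 2) ∧
      (Even n → (numRootedSpanningForests (circulant n s) : ℤ) = (q : ℤ) * a n ^ 2) := by
  classical
  obtain ⟨hsf, r, -, hr⟩ := hq
  have key : ∀ n : ℕ, ∃ a : ℤ, 0 < n → (∀ i, 2 * s i < n) →
      (Odd n → (numRootedSpanningForests (circulant n s) : ℤ) = a ^ 2) ∧
      (Even n → (numRootedSpanningForests (circulant n s) : ℤ) = (q : ℤ) * a ^ 2) := by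
    intro n
    by_cases hn : 0 < n ∧ ∀ i, 2 * s i < n
    · obtain ⟨h0, hlt⟩ := hn
      have : NeZero n := ⟨h0.ne'⟩
      have hdet : (numRootedSpanningForests (circulant n s) : ℚ) =
          LinearMap.det (M := evenPeriodTwo n) (circulantOpPeriodTwo n s) *
            LinearMap.det (circulantOpOdd n s) ^ 2 := by
        rw [numRootedSpanningForests_eq_det, ← LinearMap.det_toLin',
          toLin'_one_add_lapMatrix_circulant s hs_pos hs.injective hlt,
          det_circulantOp_eq_periodTwo_mul_sq]
      rcases Nat.even_or_odd n with hpar | hpar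
      · rw [det_circulantOpPeriodTwo_of_even s hpar, ← hp] at hdet
        have hr' : (4 * p + 1 : ℚ) = q * r ^ 2 := by exact_mod_cast hr
        obtain ⟨a, ha⟩ := exists_eq_mul_int_sq hsf
          (c := r * LinearMap.det (circulantOpOdd n s)) (hdet.trans (by rw [hr']; ring))
        exact ⟨a, fun _ _ => ⟨fun ho => absurd hpar (Nat.not_even_iff_odd.2 ho), fun _ => ha⟩⟩
      · rw [det_circulantOpPeriodTwo_of_odd s hpar] at hdet
        obtain ⟨a, ha⟩ := exists_eq_mul_int_sq (q := 1) squarefree_one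
          (hdet.trans (by rw [Nat.cast_one]))
        rw [Nat.cast_one, one_mul] at ha
        exact ⟨a, fun _ _ => ⟨fun _ => ha, fun he => absurd hpar (Nat.not_odd_iff_even.2 he)⟩⟩
    · exact ⟨0, fun h0 hlt => absurd ⟨h0, hlt⟩ hn⟩
  choose a ha using key
  exact ⟨a, ha⟩
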